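/- Let $K$ be a field of characteristic zero and $n\ge 3$. Let $\mathfrak S_n$ act on the polynomial ring $K[x_{\{i,j\}} : 1\le i<j\le n]$ in $m=\binom n2$ variables by $\sigma\cdot x_{\{i,j\}}=x_{\{\sigma(i),\sigma(j)\}}$, let $\mathcal I_n$ be the ring of invariants, and put $X_i=\sum_{j\ne i}x_{\{i,j\}}$ for $1\le i\le n$. A family of $m$ homogeneous elements $\theta_1,\dots,\theta_m\in\mathcal I_n$ of positive degree is a homogeneous system of parameters of $\mathcal I_n$ if $\mathcal I_n$ is a finitely generated module over its subring $K[\theta_1,\dots,\theta_m]$. Consider the edge power sums and the vertex-degree power sums $$\sum_{i<j}x_{\{i,j\}}^{k}\quad\Bigl(1\le k\le\tbinom{n-1}{2}\Bigr),\qquad \sum_{i=1}^nX_i^{k}\quad(1\le k\le n).$$ The two invariants of degree $1$ in this list are proportional: $X_1+\dots+X_n=2\sum_{i<j}x_{\{i,j\}}$. **Proposition.** For $3\le n\le 5$, these invariants, with the repetition in degree $1$ removed (either one of the two proportional linear invariants being omitted), form a homogeneous system of parameters of $\mathcal I_n$. -/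

import Mathlib

open scoped BigOperators

/-- The edges on the vertex set `Fin n`: unordered pairs `{i, j}` with `i ≠ j`. -/
abbrev Edge (n : ℕ) : Type := {e : Sym2 (Fin n) // ¬ e.IsDiag}

namespace GraphInvariants

/-- The action of a permutation of the vertices on the edges, `{i, j} ↦ {σ i, σ j}`. -/
def edgePerm {n : ℕ} (σ : Equiv.Perm (Fin n)) : Equiv.Perm (Edge n) where
  toFun e := ⟨Sym2.map σ e.1, by rw [Sym2.isDiag_map σ.injective]; exact e.2⟩
  invFun e := ⟨Sym2.map σ.symm e.1, by rw [Sym2.isDiag_map σ.symm.injective]; exact e.2⟩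
  left_inv e := by simp [Sym2.map_map]
  right_inv e := by simp [Sym2.map_map]

theorem coe_edgePerm {n : ℕ} (σ : Equiv.Perm (Fin n)) (e : Edge n) :
    (edgePerm σ e : Sym2 (Fin n)) = Sym2.map σ (e : Sym2 (Fin n)) := rfl

/-- The invariant ring over graphs: the polynomials in the variables `x_{i,j}` that are fixed by
all substitutions `x_{i,j} ↦ x_{σ i, σ j}`. -/
def invariantRing (K : Type*) [Field K] (n : ℕ) : Subalgebra K (MvPolynomial (Edge n) K) where
  carrier := {p | ∀ σ : Equiv.Perm (Fin n), MvPolynomial.rename (edgePerm σ) p = p}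
  mul_mem' := fun {p q} hp hq σ => by rw [map_mul, hp σ, hq σ]
  add_mem' := fun {p q} hp hq σ => by rw [map_add, hp σ, hq σ]
  algebraMap_mem' := fun r σ => by simp

/-- The linear form `X_i = ∑_{j ≠ i} x_{i,j}`, the sum of the variables of the edges incident
with the vertex `i`. -/
noncomputable def vertexDegree (K : Type*) [Field K] (n : ℕ) (i : Fin n) :
    MvPolynomial (Edge n) K :=
  ∑ e ∈ Finset.univ.filter (fun e : Edge n => i ∈ (e : Sym2 (Fin n))), MvPolynomial.X e

theorem rename_vertexDegree (K : Type*) [Field K] (n : ℕ) (σ : Equiv.Perm (Fin n)) (i : Fin n) :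
    MvPolynomial.rename (edgePerm σ) (vertexDegree K n i) = vertexDegree K n (σ i) := by
  simp only [vertexDegree, map_sum, MvPolynomial.rename_X]
  refine Finset.sum_equiv (edgePerm σ) (fun e => ?_) (fun e _ => rfl)
  simp [coe_edgePerm, Sym2.mem_map]

/-- The edge power sum `∑_{i,j} x_{i,j} ^ k`, as an invariant. -/
noncomputable def edgePowerSum (K : Type*) [Field K] (n k : ℕ) : invariantRing K n :=
  ⟨∑ e : Edge n, MvPolynomial.X e ^ k, fun σ => by
    simp only [map_sum, map_pow, MvPolynomial.rename_X]
    exact Equiv.sum_comp (edgePerm σ) fun e => (MvPolynomial.X e : MvPolynomial (Edge n) K) ^ k⟩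

/-- The vertex-degree power sum `∑_i X_i ^ k`, as an invariant. -/
noncomputable def vertexPowerSum (K : Type*) [Field K] (n k : ℕ) : invariantRing K n :=
  ⟨∑ i : Fin n, vertexDegree K n i ^ k, fun σ => by
    simp only [map_sum, map_pow, rename_vertexDegree]
    exact Equiv.sum_comp σ fun i => vertexDegree K n i ^ k⟩

/-- A family `θ` of elements of an invariant ring `A ⊆ K[x_1, …, x_m]` is a homogeneous system of
parameters if it consists of `m` homogeneous invariants of positive degree and `A` is a finitely
generated module over its subring `K[θ]`. -/
structure IsHomogeneousSystemOfParameters {K : Type*} [Field K] {τ ι : Type*} [Fintype τ]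
    [Fintype ι] (A : Subalgebra K (MvPolynomial τ K)) (θ : ι → A) : Prop where
  card_eq : Fintype.card ι = Fintype.card τ
  homogeneous : ∀ i, ∃ d, 0 < d ∧ (θ i : MvPolynomial τ K).IsHomogeneous d
  finite : Module.Finite (Algebra.adjoin K (Set.range θ)) A

end GraphInvariants

/-! Finiteness over `K[θ]` follows once the origin is the only common zero of the `θ i` over every
extension field of `K`. This is proved by valuations: a variable not integral over `K[θ]` yields,
after rescaling and reduction to a residue field, a nonzero common zero.

At a common zero the vertex power sums force every degree `X_i` to vanish
(`eq_zero_of_sum_pow_eq_zero`). For `n = 3` the degrees determine the edges. For `n = 4` opposite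
edges become equal, leaving three values with three vanishing power sums. For `n = 5` a space of
dimension 5 remains, on which the edge power sums of degrees 2 to 6 are expressed in invariants of
the permutations of four vertices. The syzygies of these invariants then leave only the origin
(`eq_zero_of_invariant_relations`). -/

/-! ### Finiteness from the absence of nontrivial common zeros -/

theorem Subalgebra.finite_of_isIntegral {K R : Type*} [Field K] [CommRing R] [Algebra K R]
    [Algebra.FiniteType K R] (A : Subalgebra K R) (B : Subalgebra K A) (hB : B.FG)
    [Algebra.IsIntegral B R] : Module.Finite B A := by
  have : Algebra.FiniteType K B := (Subalgebra.fg_iff_finiteType B).1 hB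
  have : IsNoetherianRing B := Algebra.FiniteType.isNoetherianRing K B
  have : Algebra.FiniteType B R := Algebra.FiniteType.of_restrictScalars_finiteType K B R
  have : Module.Finite B R := Algebra.IsIntegral.finite
  -- `A` is a submodule of the Noetherian `B`-module `R`, so no prior finite generation of `A` is
  -- needed.
  exact Module.Finite.of_injective (IsScalarTower.toAlgHom B A R).toLinearMap
    Subtype.val_injective

/-- An element of a field that is not integral over a ring is avoided by some valuation subring
containing that ring. -/
theorem exists_valuationSubring_of_not_isIntegral {B F : Type*} [CommRing B] [Field F]
    [Algebra B F] {x : F} (hx : ¬ IsIntegral B x) :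
    ∃ V : ValuationSubring F, (∀ b : B, algebraMap B F b ∈ V) ∧ x ∉ V := by
  have : IsIntegrallyClosedIn (integralClosure B F).toSubring F :=
    inferInstanceAs (IsIntegrallyClosedIn (integralClosure B F) F)
  obtain ⟨V, hV, hxV⟩ := Subring.exists_le_valuationSubring_of_isIntegrallyClosedIn
    (R := (integralClosure B F).toSubring) (x := x) hx
  exact ⟨V, fun b => hV (Subalgebra.algebraMap_mem (integralClosure B F) b), hxV⟩

/-- A valuative criterion: if the only common zero of the homogeneous invariants `θ` over every
extension of the ground field is the origin, then the ambient polynomial ring is integral over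
`K[θ]`. -/
theorem isIntegral_X_of_forall_eq_zero.{u, v, w} {K : Type u} [Field K]
    {τ : Type v} {ι : Type w} [Finite τ] (A : Subalgebra K (MvPolynomial τ K)) (θ : ι → A)
    (hom : ∀ i, ∃ d, 0 < d ∧ (θ i : MvPolynomial τ K).IsHomogeneous d)
    (hzero : ∀ (k : Type (max u v)) [Field k] (f : K →+* k) (x : τ → k),
      (∀ i, MvPolynomial.eval₂ f x (θ i : MvPolynomial τ K) = 0) → x = 0) (e : τ) :
    IsIntegral (Algebra.adjoin K (Set.range θ)) (MvPolynomial.X e : MvPolynomial τ K) := by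
  set B := Algebra.adjoin K (Set.range θ) with hB
  let F := FractionRing (MvPolynomial τ K)
  let φ : MvPolynomial τ K →+* F := algebraMap _ F
  have hφ : Function.Injective φ := IsFractionRing.injective _ _
  rw [← isIntegral_algebraMap_iff (B := F) hφ]
  by_contra hne
  obtain ⟨V, hV, heV⟩ := exists_valuationSubring_of_not_isIntegral hne
  have hBV (b : B) : φ (b : A) ∈ V := hV b
  have : Nonempty τ := ⟨e⟩
  -- Dividing by a variable of largest valuation puts all coordinates in `V`, with the `m`-th equal
  -- to 1.
  obtain ⟨m, hm⟩ := Finite.exists_max fun i : τ => V.valuation (φ (MvPolynomial.X i))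
  have hmV : φ (MvPolynomial.X m) ∉ V := fun h =>
    heV ((V.valuation_le_one_iff _).1 ((hm e).trans ((V.valuation_le_one_iff _).2 h)))
  have hm0 : φ (MvPolynomial.X m) ≠ 0 := fun h => hmV (h ▸ V.zero_mem)
  have hinv : (φ (MvPolynomial.X m))⁻¹ ∈ V := (V.mem_or_inv_mem _).resolve_left hmV
  let w : V := ⟨_, hinv⟩
  have hw : IsLocalRing.residue V w = 0 := by
    rw [IsLocalRing.residue_eq_zero_iff, IsLocalRing.mem_maximalIdeal, mem_nonunits_iff]
    intro hu
    obtain ⟨v, hv⟩ := hu.exists_right_inv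
    have hv' : (φ (MvPolynomial.X m))⁻¹ * (v : F) = 1 := congrArg Subtype.val hv
    have : (v : F) = φ (MvPolynomial.X m) := ((inv_mul_eq_one₀ hm0).1 hv').symm
    exact hmV (this ▸ v.2)
  have hy (i : τ) : φ (MvPolynomial.X i) * (φ (MvPolynomial.X m))⁻¹ ∈ V := by
    rw [← V.valuation_le_one_iff, map_mul, map_inv₀]
    exact mul_inv_le_one_of_le₀ (hm i) zero_le
  let y : τ → V := fun i => ⟨_, hy i⟩
  let g : K →+* V := (φ.comp MvPolynomial.C).codRestrict V.toSubring
    fun r => hBV (algebraMap K B r)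
  -- By homogeneity the value at the rescaled point is `θ i / X_m ^ d`. Since `θ i` lies in `V` and
  -- `1 / X_m` in its maximal ideal, this value vanishes in the residue field.
  have key (i : ι) (d : ℕ) (hd : (θ i : MvPolynomial τ K).IsHomogeneous d) :
      MvPolynomial.eval₂ g y (θ i : MvPolynomial τ K) =
        ⟨φ (θ i), hBV ⟨θ i, Algebra.subset_adjoin ⟨i, rfl⟩⟩⟩ * w ^ d := by
    apply V.subtype_injective
    rw [MvPolynomial.hom_eval₂]
    simp only [map_mul, map_pow]
    change _ = φ (θ i) * (φ (MvPolynomial.X m))⁻¹ ^ d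
    have h1 : φ (θ i) = MvPolynomial.eval₂ (φ.comp MvPolynomial.C)
        (fun j => φ (MvPolynomial.X j)) (θ i : MvPolynomial τ K) := by
      conv_lhs => rw [← MvPolynomial.eval₂_eta (θ i : MvPolynomial τ K), MvPolynomial.hom_eval₂]
    rw [h1, MvPolynomial.eval₂_eq, MvPolynomial.eval₂_eq, Finset.sum_mul]
    refine Finset.sum_congr rfl fun a ha => ?_
    have hda : ∑ j ∈ a.support, a j = d := by
      have := hd (MvPolynomial.mem_support_iff.1 ha)
      rwa [Finsupp.weight_apply, Finsupp.sum, Finset.sum_congr rfl fun j _ => by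
        rw [Pi.one_apply, smul_eq_mul, mul_one]] at this
    rw [mul_assoc, ← hda, ← Finset.prod_pow_eq_pow_sum, ← Finset.prod_mul_distrib]
    simp only [← mul_pow]
    rfl
  have h0 := hzero (IsLocalRing.ResidueField V) ((IsLocalRing.residue V).comp g)
    (fun j => IsLocalRing.residue V (y j)) fun i => by
      obtain ⟨d, hd0, hd⟩ := hom i
      rw [← MvPolynomial.hom_eval₂, key i d hd, map_mul, map_pow, hw, zero_pow hd0.ne', mul_zero]
  have h1 : y m = 1 := Subtype.ext (mul_inv_cancel₀ hm0)
  have := congrFun h0 m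
  simp [h1] at this

theorem finite_adjoin_of_forall_eq_zero.{u, v, w} {K : Type u} [Field K]
    {τ : Type v} {ι : Type w} [Finite τ] [Finite ι] (A : Subalgebra K (MvPolynomial τ K)) (θ : ι → A)
    (hom : ∀ i, ∃ d, 0 < d ∧ (θ i : MvPolynomial τ K).IsHomogeneous d)
    (hzero : ∀ (k : Type (max u v)) [Field k] (f : K →+* k) (x : τ → k),
      (∀ i, MvPolynomial.eval₂ f x (θ i : MvPolynomial τ K) = 0) → x = 0) :
    Module.Finite (Algebra.adjoin K (Set.range θ)) A := by
  have hX := isIntegral_X_of_forall_eq_zero A θ hom hzero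
  set B := Algebra.adjoin K (Set.range θ) with hB
  have : Algebra.IsIntegral B (MvPolynomial τ K) := ⟨fun p => by
    induction p using MvPolynomial.induction_on with
    | C r => exact isIntegral_algebraMap (R := B) (x := algebraMap K B r)
    | add p q hp hq => exact hp.add hq
    | mul_X p i hp => exact hp.mul (hX i)⟩
  exact A.finite_of_isIntegral B (Subalgebra.fg_def.2 ⟨_, Set.finite_range θ, rfl⟩)

/-! ### Vanishing power sums -/

/-- In characteristic zero, `n` elements whose first `n` power sums vanish are all zero. -/
theorem eq_zero_of_sum_pow_eq_zero {k : Type*} [Field k] [CharZero k] {ι : Type*} [Fintype ι]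
    (x : ι → k) (h : ∀ j, 1 ≤ j → j ≤ Fintype.card ι → ∑ i, x i ^ j = 0) (i : ι) : x i = 0 := by
  classical
  by_contra hi
  -- `Q` vanishes at 0 and at every value other than `x i`. Having no constant term, its sum over
  -- the family is a combination of power sums of positive degree, hence 0. That sum is also the
  -- multiplicity of `x i` times `Q (x i)`, which is nonzero in characteristic zero.
  set Q : Polynomial k := Polynomial.X *
    ∏ v ∈ (Finset.univ.image x).erase (x i), (Polynomial.X - Polynomial.C v) with hQ
  have hdeg : Q.natDegree ≤ Fintype.card ι := by
    refine Polynomial.natDegree_mul_le.trans ?_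
    rw [Polynomial.natDegree_X, Polynomial.natDegree_finsetProd_X_sub_C_eq_card,
      Finset.card_erase_of_mem (Finset.mem_image_of_mem x (Finset.mem_univ i))]
    have h1 : 0 < (Finset.univ.image x).card :=
      Finset.card_pos.2 ⟨x i, Finset.mem_image_of_mem x (Finset.mem_univ i)⟩
    have h2 : (Finset.univ.image x).card ≤ Fintype.card ι := Finset.card_image_le
    omega
  have hsum : ∑ l, Q.eval (x l) = 0 := by
    simp only [Polynomial.eval_eq_sum_range]
    rw [Finset.sum_comm]
    refine Finset.sum_eq_zero fun j hj => ?_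
    rw [← Finset.mul_sum]
    rcases Nat.eq_zero_or_pos j with rfl | hj0
    · simp [hQ]
    · rw [h j hj0 (by have := Finset.mem_range.1 hj; omega), mul_zero]
  have hval (l : ι) : Q.eval (x l) = if x l = x i then Q.eval (x i) else 0 := by
    split_ifs with hl
    · rw [hl]
    · rw [hQ, Polynomial.eval_mul, Polynomial.eval_prod,
        Finset.prod_eq_zero (i := x l) (by simp [hl]) (by simp), mul_zero]
  have hne : Q.eval (x i) ≠ 0 := by
    rw [hQ, Polynomial.eval_mul, Polynomial.eval_prod]
    refine mul_ne_zero (by simpa using hi) (Finset.prod_ne_zero_iff.2 fun v hv => ?_)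
    rw [Polynomial.eval_sub, Polynomial.eval_X, Polynomial.eval_C]
    exact sub_ne_zero.2 (Finset.ne_of_mem_erase hv).symm
  rw [Finset.sum_congr rfl fun l _ => hval l, ← Finset.sum_filter, Finset.sum_const, nsmul_eq_mul] at hsum
  rcases mul_eq_zero.1 hsum with h | h
  · rw [Nat.cast_eq_zero, Finset.card_eq_zero] at h
    exact absurd (h ▸ Finset.mem_filter.2 ⟨Finset.mem_univ i, rfl⟩) (Finset.notMem_empty i)
  · exact hne h

/-! ### Elimination for five vertices -/

/-- For two zero-sum triples `(s, t, u)` and `(a', b', c')`, put `q = I x² + J xy + L y²`, one sixth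
of the sum of the squares of the forms `s x + a' y`, and `F = M x³ + 3N x²y + 3C xy² + S y³`, their
product. Then `r7` and `r8` say that `q` is apolar to `F`, while `r8'` and `r9` compare two
coefficients of the Hessian of `F` with those of `q` times its discriminant. The other hypotheses
are the edge equations. With `s` in degree 1 and `a'` in degree 2, the weights of `I, J, M, N, L, C,
S` are 2, 3, 3, 4, 4, 5, 6, and the names `r7` to `r9` record the weight of the relation. -/
theorem eq_zero_of_invariant_relations {k : Type*} [Field k] [CharZero k] {I J M N L C S : k}
    (hL : 9 * L = 9 * N + 7 * I ^ 2) (hC : 3 * C = -3 * I * M - 26 * I * J)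
    (hS : 16 * S = (M + 3 * J) ^ 2 - 32 * I * L + 128 / 27 * I ^ 3)
    (h6 : 147 * M ^ 2 + 32 * I ^ 3 + 4656 * I * N + 1314 * J * M + 1611 * J ^ 2 = 0)
    (r7 : L * M - J * N + I * C = 0) (r8 : L * N - J * C + I * S = 0)
    (r8' : M * C - N ^ 2 = I * (J ^ 2 - 4 * I * L))
    (r9 : M * S - N * C = J * (J ^ 2 - 4 * I * L)) : I = 0 ∧ J = 0 ∧ M = 0 ∧ N = 0 := by
  obtain rfl : L = N + 7 / 9 * I ^ 2 := by linear_combination hL / 9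
  obtain rfl : C = -I * M - 26 / 3 * I * J := by linear_combination hC / 3
  obtain rfl : S = ((M + 3 * J) ^ 2 - 32 * I * (N + 7 / 9 * I ^ 2) + 128 / 27 * I ^ 3) / 16 := by
    linear_combination hS / 16
  -- After eliminating `L`, `C`, `S`, this certificate is homogeneous of weight 14.
  have hI : I ^ 7 = 0 := by
    linear_combination (
      (14592000 * I^4 - 13142400 * N^2 - 129654255 * I*J^2 + 127305 * I*M^2
        - 10658650 * I*J*M + 13354400 * I^2*N) / 8 * h6 +
      (61920 * M*N - 62959680 * I^2*J - 4313280 * I^2*M + 3503520 * J*N) * r7 +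
      (8235293760 * I*N + 2850722586 * J^2 + 260020170 * M^2 + 2321775900 * J*M) * r8 +
      (586416960 * I*N + 200668266 * J^2 + 18590490 * M^2 + 166578300 * J*M) * r8') / 58368000
  obtain rfl : I = 0 := eq_zero_of_pow_eq_zero hI
  obtain rfl : N = 0 := eq_zero_of_pow_eq_zero (n := 2) (by linear_combination -r8')
  -- Now `h6` and `r9` are binary forms in `M`, `J` of degrees 2 and 3. Up to a scalar this is the
  -- remainder of the cubic divided by the quadratic; the factor 2401 = 49² clears denominators.
  have hMJ : J ^ 2 * (3 * M + 2 * J) = 0 := by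
    linear_combination (2401 * 16 * r9 - (49 * M - 144 * J) * h6 / 3) / 19456
  have hJ : J ^ 4 = 0 := by
    linear_combination (3 * J ^ 2 * h6 - (147 * M + 1216 * J) * hMJ) / 2401
  obtain rfl : J = 0 := eq_zero_of_pow_eq_zero hJ
  obtain rfl : M = 0 := eq_zero_of_pow_eq_zero (n := 2) (by linear_combination h6 / 147)
  simp

/-- The equations are symmetric under simultaneous permutations of the pairs `(s, a)`, `(t, b)`,
`(u, c)`, so they can be rewritten in the invariants of two triples. -/
theorem eq_zero_of_bisymmetric_relations {k : Type*} [Field k] [CharZero k] {s t u a b c d : k}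
    (g1 : s + t + u = 0)
    (g2 : s ^ 2 + t ^ 2 + u ^ 2 + 3 * (a + b + c) = 0)
    (g3 : s ^ 3 + t ^ 3 + u ^ 3 + 3 * (s * a + t * b + u * c) + 12 * d = 0)
    (g4 : s ^ 4 + t ^ 4 + u ^ 4 + 6 * (s ^ 2 * a + t ^ 2 * b + u ^ 2 * c) +
      3 * (a ^ 2 + b ^ 2 + c ^ 2) + 12 * (a * b + b * c + c * a) = 0)
    (g5 : s ^ 5 + t ^ 5 + u ^ 5 + 10 * (s ^ 3 * a + t ^ 3 * b + u ^ 3 * c) +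
      5 * (s * a ^ 2 + t * b ^ 2 + u * c ^ 2) + 40 * d * (a + b + c) = 0)
    (g6 : s ^ 6 + t ^ 6 + u ^ 6 + 15 * (s ^ 4 * a + t ^ 4 * b + u ^ 4 * c) +
      15 * (s ^ 2 * a ^ 2 + t ^ 2 * b ^ 2 + u ^ 2 * c ^ 2) + 3 * (a ^ 3 + b ^ 3 + c ^ 3) +
      30 * (a ^ 2 * (b + c) + b ^ 2 * (c + a) + c ^ 2 * (a + b)) + 180 * (a * b * c) = 0)
    (g7 : a * b * c = d ^ 2) : s = 0 ∧ t = 0 ∧ u = 0 ∧ a = 0 ∧ b = 0 ∧ c = 0 := by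
  obtain rfl : u = -s - t := by linear_combination g1
  obtain rfl : c = -(s ^ 2 + t ^ 2 + (-s - t) ^ 2) / 3 - a - b := by linear_combination g2 / 3
  set c := -(s ^ 2 + t ^ 2 + (-s - t) ^ 2) / 3 - a - b with hc
  obtain rfl : d = -(s ^ 3 + t ^ 3 + (-s - t) ^ 3 + 3 * (s * a + t * b + (-s - t) * c)) / 12 := by
    linear_combination g3 / 12
  -- By `g2`, `a + b + c = -2 I`, so adding `2/3 I` to each of `a`, `b`, `c` makes the second triple
  -- zero-sum. The invariants below are those of the shifted triple. By `g3`, `d = -(M + 3 J) / 4`,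
  -- which turns `g7` into the relation for `S`.
  set I := (s ^ 2 + s * t + t ^ 2) / 3 with hI
  obtain ⟨hI0, hJ0, hM0, hN0⟩ := eq_zero_of_invariant_relations (I := I)
    (J := (s * a + t * b + (-s - t) * c) / 3)
    (M := -s * t * (s + t))
    (N := (s ^ 2 * a + t ^ 2 * b + (-s - t) ^ 2 * c + 4 * I ^ 2) / 3)
    (L := -(a * b + b * c + c * a - 4 / 3 * I ^ 2) / 3)
    (C := (s * a ^ 2 + t * b ^ 2 + (-s - t) * c ^ 2
      + 4 / 3 * I * (s * a + t * b + (-s - t) * c)) / 3)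
    (S := (a + 2 / 3 * I) * (b + 2 / 3 * I) * (c + 2 / 3 * I))
    (by linear_combination -g4 / 2) (by linear_combination g5 / 5)
    (by linear_combination 16 * g7) (by linear_combination 16 * g6 + 192 * I * g4 - 1584 * g7)
    (by ring) (by ring) (by ring) (by ring)
  -- `s`, `t`, `u` are the roots of `X³ - 3 I X - M`.
  have hs : s = 0 := eq_zero_of_pow_eq_zero (n := 3) (by linear_combination 3 * s * hI0 + hM0)
  have ht : t = 0 := eq_zero_of_pow_eq_zero (n := 3) (by linear_combination 3 * t * hI0 + hM0)
  clear_value c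
  subst hs ht
  have hab : a * b + b * c + c * a = 0 := by
    linear_combination g4 / 6 - (a + b + c) / 2 * hc
  have habc : a * b * c = 0 := by linear_combination g7
  have hsum : a + b + c = 0 := by linear_combination hc
  have key (x : k) (hx : (x - a) * (x - b) * (x - c) = 0) : x = 0 :=
    eq_zero_of_pow_eq_zero (n := 3) (by linear_combination hx + x ^ 2 * hsum - x * hab + habc)
  exact ⟨rfl, rfl, by simp, key a (by ring), key b (by ring), key c (by ring)⟩

/-- Even sign changes of `(A, B, C)` permute the ten values, so the power sums are polynomials in
`s`, `t`, `u`, the squares `A²`, `B²`, `C²` and the product `ABC`, tied by `A² B² C² = (ABC)²`. -/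
theorem eq_zero_of_edge_power_sums {k : Type*} [Field k] [CharZero k] {s t u A B C : k}
    (h1 : s + t + u = 0)
    (h : ∀ j, 2 ≤ j → j ≤ 6 → (s + A) ^ j + (s - A) ^ j + (t + B) ^ j + (t - B) ^ j + (u + C) ^ j +
      (u - C) ^ j + (A + B + C) ^ j + (A - B - C) ^ j + (-A + B - C) ^ j + (-A - B + C) ^ j = 0) :
    s = 0 ∧ t = 0 ∧ u = 0 ∧ A = 0 ∧ B = 0 ∧ C = 0 := by
  have h2 := h 2 (by norm_num) (by norm_num)
  have h3 := h 3 (by norm_num) (by norm_num)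
  have h4 := h 4 (by norm_num) (by norm_num)
  have h5 := h 5 (by norm_num) (by norm_num)
  have h6 := h 6 (by norm_num) (by norm_num)
  obtain ⟨hs, ht, hu, hA, hB, hC⟩ := eq_zero_of_bisymmetric_relations (s := s) (t := t) (u := u)
    (a := A ^ 2) (b := B ^ 2) (c := C ^ 2) (d := A * B * C) h1
    (by linear_combination h2 / 2) (by linear_combination h3 / 2) (by linear_combination h4 / 2)
    (by linear_combination h5 / 2) (by linear_combination h6 / 2) (by ring)
  exact ⟨hs, ht, hu, eq_zero_of_pow_eq_zero hA, eq_zero_of_pow_eq_zero hB,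
    eq_zero_of_pow_eq_zero hC⟩

/-! ### Common zeros on three, four and five vertices -/

namespace GraphInvariants

/-- The edge `{i, j}`. -/
def edge {n : ℕ} (i j : Fin n) (h : i ≠ j) : Edge n := ⟨s(i, j), by simpa using h⟩

theorem mem_edge {n : ℕ} {i j l : Fin n} (h : i ≠ j) :
    l ∈ (edge i j h : Sym2 (Fin n)) ↔ l = i ∨ l = j := Sym2.mem_iff

theorem univ_edge_three : (Finset.univ : Finset (Edge 3)) =
    {edge 0 1 (by decide), edge 0 2 (by decide), edge 1 2 (by decide)} := by decide

theorem univ_edge_four : (Finset.univ : Finset (Edge 4)) =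
    {edge 0 1 (by decide), edge 0 2 (by decide), edge 0 3 (by decide), edge 1 2 (by decide),
      edge 1 3 (by decide), edge 2 3 (by decide)} := by decide

theorem univ_edge_five : (Finset.univ : Finset (Edge 5)) =
    {edge 0 1 (by decide), edge 0 2 (by decide), edge 0 3 (by decide), edge 0 4 (by decide),
      edge 1 2 (by decide), edge 1 3 (by decide), edge 1 4 (by decide), edge 2 3 (by decide),
      edge 2 4 (by decide), edge 3 4 (by decide)} := by decide

theorem sum_edge_three {k : Type*} [AddCommMonoid k] (f : Edge 3 → k) :
    ∑ e, f e = f (edge 0 1 (by decide)) + f (edge 0 2 (by decide)) + f (edge 1 2 (by decide)) := by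
  rw [univ_edge_three]
  iterate 2 rw [Finset.sum_insert (by decide)]
  rw [Finset.sum_singleton, add_assoc]

theorem sum_edge_four {k : Type*} [AddCommMonoid k] (f : Edge 4 → k) :
    ∑ e, f e = f (edge 0 1 (by decide)) + f (edge 0 2 (by decide)) + f (edge 0 3 (by decide)) +
      f (edge 1 2 (by decide)) + f (edge 1 3 (by decide)) + f (edge 2 3 (by decide)) := by
  rw [univ_edge_four]
  iterate 5 rw [Finset.sum_insert (by decide)]
  rw [Finset.sum_singleton]
  simp only [add_assoc]

theorem sum_edge_five {k : Type*} [AddCommMonoid k] (f : Edge 5 → k) :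
    ∑ e, f e = f (edge 0 1 (by decide)) + f (edge 0 2 (by decide)) + f (edge 0 3 (by decide)) +
      f (edge 0 4 (by decide)) + f (edge 1 2 (by decide)) + f (edge 1 3 (by decide)) +
      f (edge 1 4 (by decide)) + f (edge 2 3 (by decide)) + f (edge 2 4 (by decide)) +
      f (edge 3 4 (by decide)) := by
  rw [univ_edge_five]
  iterate 9 rw [Finset.sum_insert (by decide)]
  rw [Finset.sum_singleton]
  simp only [add_assoc]

section CommonZeros

variable {k : Type*} [Field k] [CharZero k]

theorem eq_zero_three (x : Edge 3 → k)
    (hX : ∀ i, ∑ e : Edge 3 with i ∈ e.1, x e = 0) : x = 0 := by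
  have h0 := hX 0
  have h1 := hX 1
  have h2 := hX 2
  simp [Finset.sum_filter, sum_edge_three, mem_edge] at h0 h1 h2
  funext e
  have he := Finset.mem_univ e
  simp only [univ_edge_three, Finset.mem_insert, Finset.mem_singleton] at he
  rcases he with rfl | rfl | rfl <;> rw [Pi.zero_apply]
  · linear_combination (h0 + h1 - h2) / 2
  · linear_combination (h0 + h2 - h1) / 2
  · linear_combination (h1 + h2 - h0) / 2

theorem eq_zero_four (x : Edge 4 → k) (hE : ∀ j, 1 ≤ j → j ≤ 3 → ∑ e, x e ^ j = 0)
    (hX : ∀ i, ∑ e : Edge 4 with i ∈ e.1, x e = 0) : x = 0 := by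
  have h0 := hX 0
  have h1 := hX 1
  have h2 := hX 2
  have h3 := hX 3
  simp [Finset.sum_filter, sum_edge_four, mem_edge] at h0 h1 h2 h3
  simp only [sum_edge_four] at hE
  generalize hx01 : x (edge 0 1 _) = x01 at *
  generalize hx02 : x (edge 0 2 _) = x02 at *
  generalize hx03 : x (edge 0 3 _) = x03 at *
  generalize hx12 : x (edge 1 2 _) = x12 at *
  generalize hx13 : x (edge 1 3 _) = x13 at *
  generalize hx23 : x (edge 2 3 _) = x23 at *
  -- Vanishing degrees force opposite edges to agree, so each edge power sum is twice a power sum of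
  -- three values.
  obtain rfl : x23 = x01 := by linear_combination (h2 + h3 - h0 - h1) / 2
  obtain rfl : x13 = x02 := by linear_combination (h1 + h3 - h0 - h2) / 2
  obtain rfl : x12 = x03 := by linear_combination (h1 + h2 - h0 - h3) / 2
  have key := eq_zero_of_sum_pow_eq_zero ![x23, x13, x12] fun j h1 h2 => by
    have := hE j h1 (by simpa using h2)
    simp only [Fin.sum_univ_three, Matrix.cons_val]
    linear_combination this / 2
  have k0 : x23 = 0 := key 0
  have k1 : x13 = 0 := key 1
  have k2 : x12 = 0 := key 2
  funext e
  have he := Finset.mem_univ e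
  simp only [univ_edge_four, Finset.mem_insert, Finset.mem_singleton] at he
  rcases he with rfl | rfl | rfl | rfl | rfl | rfl <;> simp_all

/-- The coordinates are adapted to the permutations of the vertices 0 to 3: `s`, `t`, `u` are the
sums over the three perfect matchings of these vertices, and `A`, `B`, `C` are sums of two edges at
vertex 4. On the Klein four-group, `s`, `t`, `u` are fixed and `A`, `B`, `C` undergo even sign
changes, because the degree of vertex 4 is zero. -/
theorem eq_zero_five (x : Edge 5 → k) (hE : ∀ j, 1 ≤ j → j ≤ 6 → ∑ e, x e ^ j = 0)
    (hX : ∀ i, ∑ e : Edge 5 with i ∈ e.1, x e = 0) : x = 0 := by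
  have h0 := hX 0
  have h1 := hX 1
  have h2 := hX 2
  have h3 := hX 3
  have h4 := hX 4
  simp [Finset.sum_filter, sum_edge_five, mem_edge] at h0 h1 h2 h3 h4
  simp only [sum_edge_five] at hE
  generalize hx01 : x (edge 0 1 _) = x01 at *
  generalize hx02 : x (edge 0 2 _) = x02 at *
  generalize hx03 : x (edge 0 3 _) = x03 at *
  generalize hx04 : x (edge 0 4 _) = x04 at *
  generalize hx12 : x (edge 1 2 _) = x12 at *
  generalize hx13 : x (edge 1 3 _) = x13 at *
  generalize hx14 : x (edge 1 4 _) = x14 at *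
  generalize hx23 : x (edge 2 3 _) = x23 at *
  generalize hx24 : x (edge 2 4 _) = x24 at *
  generalize hx34 : x (edge 3 4 _) = x34 at *
  have e01 : x01 + x23 - (x04 + x14) = 2 * x01 := by linear_combination (h2 + h3 - h0 - h1 - h4) / 2
  have e23 : x01 + x23 + (x04 + x14) = 2 * x23 := by linear_combination -(h2 + h3 - h0 - h1 - h4) / 2
  have e02 : x02 + x13 - (x04 + x24) = 2 * x02 := by linear_combination (h1 + h3 - h0 - h2 - h4) / 2
  have e13 : x02 + x13 + (x04 + x24) = 2 * x13 := by linear_combination -(h1 + h3 - h0 - h2 - h4) / 2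
  have e03 : x03 + x12 - (x04 + x34) = 2 * x03 := by linear_combination (h1 + h2 - h0 - h3 - h4) / 2
  have e12 : x03 + x12 + (x04 + x34) = 2 * x12 := by linear_combination -(h1 + h2 - h0 - h3 - h4) / 2
  have e04 : x04 + x14 + (x04 + x24) + (x04 + x34) = 2 * x04 := by linear_combination h4
  have e14 : x04 + x14 - (x04 + x24) - (x04 + x34) = 2 * x14 := by linear_combination -h4
  have e24 : -(x04 + x14) + (x04 + x24) - (x04 + x34) = 2 * x24 := by linear_combination -h4
  have e34 : -(x04 + x14) - (x04 + x24) + (x04 + x34) = 2 * x34 := by linear_combination -h4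
  obtain ⟨ks, kt, ku, kA, kB, kC⟩ := eq_zero_of_edge_power_sums (s := x01 + x23) (t := x02 + x13)
    (u := x03 + x12) (A := x04 + x14) (B := x04 + x24) (C := x04 + x34)
    (by linear_combination (h0 + h1 + h2 + h3 - h4) / 2) fun j hj hj' => by
      rw [e01, e23, e02, e13, e03, e12, e04, e14, e24, e34]
      simp only [mul_pow]
      -- The ten values are the doubled edge variables.
      linear_combination 2 ^ j * hE j (by omega) hj'
  rw [ks, kA] at e01 e23
  rw [kt, kB] at e02 e13
  rw [ku, kC] at e03 e12
  rw [kA, kB, kC] at e04 e14 e24 e34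
  funext e
  have he := Finset.mem_univ e
  simp only [univ_edge_five, Finset.mem_insert, Finset.mem_singleton] at he
  rcases he with rfl | rfl | rfl | rfl | rfl | rfl | rfl | rfl | rfl | rfl <;> simp_all

/-- The edge and vertex-degree power sums have no common zero but the origin. -/
theorem eq_zero_of_power_sums {n : ℕ} (h3 : 3 ≤ n) (h5 : n ≤ 5) (x : Edge n → k)
    (hE : ∀ j, 1 ≤ j → j ≤ (n - 1).choose 2 → ∑ e, x e ^ j = 0)
    (hX : ∀ j, 1 ≤ j → j ≤ n → ∑ i, (∑ e : Edge n with i ∈ e.1, x e) ^ j = 0) : x = 0 := by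
  have hX' : ∀ i, ∑ e : Edge n with i ∈ e.1, x e = 0 := by
    refine eq_zero_of_sum_pow_eq_zero _ fun j h1 h2 => ?_
    rw [Fintype.card_fin] at h2
    exact hX j h1 h2
  obtain rfl | rfl | rfl : n = 3 ∨ n = 4 ∨ n = 5 := by omega
  · exact eq_zero_three x hX'
  · exact eq_zero_four x hE hX'
  · exact eq_zero_five x hE hX'

end CommonZeros

/-! ### The parameter families: degrees, evaluation and count -/

theorem vertexPowerSum_one (K : Type*) [Field K] (n : ℕ) :
    vertexPowerSum K n 1 = 2 * edgePowerSum K n 1 := by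
  apply Subtype.ext
  change ∑ i, vertexDegree K n i ^ 1 = 2 * ∑ e : Edge n, MvPolynomial.X e ^ 1
  simp only [pow_one, vertexDegree, Finset.sum_filter]
  rw [Finset.sum_comm, Finset.mul_sum]
  refine Finset.sum_congr rfl fun e _ => ?_
  rw [← Finset.sum_filter, Finset.sum_const]
  have : (Finset.univ.filter fun i => i ∈ (e : Sym2 (Fin n))).card = 2 := by
    obtain ⟨e, he⟩ := e
    induction e using Sym2.ind with
    | _ i j =>
      rw [← Finset.card_pair (a := i) (b := j) (by simpa using he)]
      congr 1
      ext l
      simp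
  rw [this, two_nsmul, two_mul]

theorem isHomogeneous_edgePowerSum (K : Type*) [Field K] (n j : ℕ) :
    (edgePowerSum K n j : MvPolynomial (Edge n) K).IsHomogeneous j :=
  MvPolynomial.IsHomogeneous.sum _ _ _ fun e _ => MvPolynomial.isHomogeneous_X_pow e j

theorem isHomogeneous_vertexPowerSum (K : Type*) [Field K] (n j : ℕ) :
    (vertexPowerSum K n j : MvPolynomial (Edge n) K).IsHomogeneous j :=
  MvPolynomial.IsHomogeneous.sum _ _ _ fun i _ => by
    have : (vertexDegree K n i).IsHomogeneous 1 :=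
      MvPolynomial.IsHomogeneous.sum _ _ _ fun e _ => MvPolynomial.isHomogeneous_X K e
    simpa using this.pow j

section Eval

variable {K k : Type*} [Field K] [Field k] (f : K →+* k) {n : ℕ} (x : Edge n → k) (j : ℕ)

theorem eval₂_edgePowerSum :
    MvPolynomial.eval₂ f x (edgePowerSum K n j : MvPolynomial (Edge n) K) = ∑ e, x e ^ j := by
  change MvPolynomial.eval₂ f x (∑ e : Edge n, MvPolynomial.X e ^ j) = _
  simp [MvPolynomial.eval₂_sum]

theorem eval₂_vertexPowerSum :
    MvPolynomial.eval₂ f x (vertexPowerSum K n j : MvPolynomial (Edge n) K) =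
      ∑ i, (∑ e : Edge n with i ∈ e.1, x e) ^ j := by
  change MvPolynomial.eval₂ f x (∑ i, vertexDegree K n i ^ j) = _
  simp [MvPolynomial.eval₂_sum, vertexDegree]

end Eval

theorem card_edge {n : ℕ} : Fintype.card (Edge n) = n.choose 2 := by
  rw [Sym2.card_subtype_not_diag, Fintype.card_fin]

/-- A homogeneous family of `n.choose 2` invariants at whose common zeros all the power sums vanish
is a homogeneous system of parameters. -/
theorem isHomogeneousSystemOfParameters_of_eval₂.{u, v} {K : Type u} [Field K] [CharZero K] {n : ℕ}
    (h3 : 3 ≤ n) (h5 : n ≤ 5) {ι : Type v} [Fintype ι] (θ : ι → invariantRing K n)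
    (hcard : Fintype.card ι = n.choose 2)
    (hom : ∀ i, ∃ d, 0 < d ∧ (θ i : MvPolynomial (Edge n) K).IsHomogeneous d)
    (hzero : ∀ (k : Type u) [Field k] [CharZero k] (f : K →+* k) (x : Edge n → k),
      (∀ i, MvPolynomial.eval₂ f x (θ i : MvPolynomial (Edge n) K) = 0) →
      (∀ j, 1 ≤ j → j ≤ (n - 1).choose 2 →
        MvPolynomial.eval₂ f x (edgePowerSum K n j : MvPolynomial (Edge n) K) = 0) ∧
      ∀ j, 1 ≤ j → j ≤ n →
        MvPolynomial.eval₂ f x (vertexPowerSum K n j : MvPolynomial (Edge n) K) = 0) :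
    IsHomogeneousSystemOfParameters (invariantRing K n) θ where
  card_eq := hcard.trans card_edge.symm
  homogeneous := hom
  finite := finite_adjoin_of_forall_eq_zero _ θ hom fun k _ f x hx => by
    -- Characteristic zero passes to the extension field, where the power sum arguments take place.
    have : CharZero k := charZero_of_injective_ringHom f.injective
    obtain ⟨hE, hV⟩ := hzero k f x hx
    exact eq_zero_of_power_sums h3 h5 x (fun j h1 h2 => eval₂_edgePowerSum f x j ▸ hE j h1 h2)
      fun j h1 h2 => eval₂_vertexPowerSum f x j ▸ hV j h1 h2

theorem eval₂_vertexPowerSum_one {K k : Type*} [Field K] [Field k] (f : K →+* k) {n : ℕ}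
    (x : Edge n → k) :
    MvPolynomial.eval₂ f x (vertexPowerSum K n 1 : MvPolynomial (Edge n) K) =
      2 * MvPolynomial.eval₂ f x (edgePowerSum K n 1 : MvPolynomial (Edge n) K) := by
  rw [vertexPowerSum_one, two_mul, two_mul, Subalgebra.coe_add, MvPolynomial.eval₂_add]

end GraphInvariants

theorem mainTheorem10 (K : Type*) [Field K] [CharZero K] (n : ℕ) (h3 : 3 ≤ n) (h5 : n ≤ 5) :
    GraphInvariants.vertexPowerSum K n 1 = 2 * GraphInvariants.edgePowerSum K n 1 ∧
    GraphInvariants.IsHomogeneousSystemOfParameters (GraphInvariants.invariantRing K n)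
      (Sum.elim
        (fun k : Finset.Icc 1 ((n - 1).choose 2) => GraphInvariants.edgePowerSum K n k)
        (fun k : Finset.Icc 2 n => GraphInvariants.vertexPowerSum K n k)) ∧
    GraphInvariants.IsHomogeneousSystemOfParameters (GraphInvariants.invariantRing K n)
      (Sum.elim
        (fun k : Finset.Icc 2 ((n - 1).choose 2) => GraphInvariants.edgePowerSum K n k)
        (fun k : Finset.Icc 1 n => GraphInvariants.vertexPowerSum K n k)) := by
  refine ⟨GraphInvariants.vertexPowerSum_one K n,
    GraphInvariants.isHomogeneousSystemOfParameters_of_eval₂ h3 h5 _ ?_ ?_ ?_,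
    GraphInvariants.isHomogeneousSystemOfParameters_of_eval₂ h3 h5 _ ?_ ?_ ?_⟩
  · rw [Fintype.card_sum, Fintype.card_coe, Fintype.card_coe]
    interval_cases n <;> decide
  · rintro (⟨j, hj⟩ | ⟨j, hj⟩) <;> rw [Finset.mem_Icc] at hj
    · exact ⟨j, by omega, GraphInvariants.isHomogeneous_edgePowerSum K n j⟩
    · exact ⟨j, by omega, GraphInvariants.isHomogeneous_vertexPowerSum K n j⟩
  · intro k _ _ f x hx
    have hE : ∀ j, 1 ≤ j → j ≤ (n - 1).choose 2 → MvPolynomial.eval₂ f x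
        (GraphInvariants.edgePowerSum K n j : MvPolynomial (Edge n) K) = 0 :=
      fun j h1 h2 => hx (.inl ⟨j, Finset.mem_Icc.2 ⟨h1, h2⟩⟩)
    refine ⟨hE, fun j h1 h2 => ?_⟩
    rcases h1.eq_or_lt with rfl | h1
    · rw [GraphInvariants.eval₂_vertexPowerSum_one,
        hE 1 le_rfl (Nat.choose_pos (by omega)), mul_zero]
    · exact hx (.inr ⟨j, Finset.mem_Icc.2 ⟨h1, h2⟩⟩)
  -- For `n = 3` the edge index set `Icc 2 1` is empty and the three vertex power sums suffice.
  · rw [Fintype.card_sum, Fintype.card_coe, Fintype.card_coe]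
    interval_cases n <;> decide
  · rintro (⟨j, hj⟩ | ⟨j, hj⟩) <;> rw [Finset.mem_Icc] at hj
    · exact ⟨j, by omega, GraphInvariants.isHomogeneous_edgePowerSum K n j⟩
    · exact ⟨j, by omega, GraphInvariants.isHomogeneous_vertexPowerSum K n j⟩
  · intro k _ _ f x hx
    have hV : ∀ j, 1 ≤ j → j ≤ n → MvPolynomial.eval₂ f x
        (GraphInvariants.vertexPowerSum K n j : MvPolynomial (Edge n) K) = 0 :=
      fun j h1 h2 => hx (.inr ⟨j, Finset.mem_Icc.2 ⟨h1, h2⟩⟩)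
    refine ⟨fun j h1 h2 => ?_, hV⟩
    -- The omitted linear edge sum is recovered from the vertex one by dividing by 2.
    rcases h1.eq_or_lt with rfl | h1
    · have := hV 1 le_rfl (by omega)
      rw [GraphInvariants.eval₂_vertexPowerSum_one] at this
      exact (mul_eq_zero.1 this).resolve_left two_ne_zero
    · exact hx (.inl ⟨j, Finset.mem_Icc.2 ⟨h1, h2⟩⟩)
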